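/- Call a cardinal $\kappa$ *accessible* if it is finite, or it is infinite and for every cardinal $\lambda$ with $\aleph_0<\lambda\le\kappa$ either $\lambda\le 2^\mu$ for some cardinal $\mu<\lambda$, or there is a set $I$ of cardinals such that $\lambda\le\sum_{\mu\in I}\mu$, $|I|<\lambda$, and $\mu<\lambda$ for all $\mu\in I$. For a set $A$, let $\mathrm{Tran}(A)$ be the complete lattice of all transitive binary relations on $A$, ordered by inclusion; with the operation $\rho\mapsto\rho^{-1}=\{(x,y):(y,x)\in\rho\}$ it is a complete involution lattice. A complete sublattice is a subset closed under the joins and meets of arbitrary nonempty families. For a positive integer $k$, a complete lattice (respectively, complete involution lattice) $L$ is *$k$-generated* if it has a $k$-element subset $X$ such that the only complete sublattice of $L$ (respectively, the only complete sublattice of $L$ closed under the involution) that includes $X$ is $L$ itself. **Theorem.** Let $A$ be a set such that $3\le|A|$ and $|A|$ is an accessible cardinal. Then $\mathrm{Tran}(A)$ is six-generated as a complete lattice, and it is three-generated as a complete involution lattice. -/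

import Mathlib

open scoped Cardinal

universe u

/-- A cardinal `κ` is *accessible* if it is finite, or it is infinite and every uncountable
cardinal `l ≤ κ` can be reached from below: either `l ≤ 2 ^ μ` for some `μ < l`, or `l` is at most
the sum of a set `I` of cardinals, where `I` has fewer than `l` elements and all members of `I` are
less than `l`. (`I` lives one universe higher than its members, hence the two lifts.) -/
def IsAccessibleCardinal (κ : Cardinal.{u}) : Prop :=
  κ < ℵ₀ ∨
    (ℵ₀ ≤ κ ∧ ∀ l : Cardinal.{u}, ℵ₀ < l → l ≤ κ →
      (∃ μ : Cardinal.{u}, μ < l ∧ l ≤ 2 ^ μ) ∨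
      (∃ I : Set Cardinal.{u},
        Cardinal.lift.{u + 1} l ≤ Cardinal.sum (fun μ : I => (μ : Cardinal.{u})) ∧
        #I < Cardinal.lift.{u + 1} l ∧
        ∀ μ ∈ I, μ < l))

/-- A *complete involution lattice*: a complete lattice with an involutive, order preserving
operation. -/
class CompleteInvolutionLattice (L : Type u) extends CompleteLattice L, InvolutiveInv L where
  inv_le_inv_of_le : ∀ x y : L, x ≤ y → x⁻¹ ≤ y⁻¹

/-- `S` is closed under the joins and the meets of arbitrary nonempty families. The empty join and
the empty meet are not among the operations, so `S` need not contain `⊥` and `⊤`. -/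
def IsCompleteSublattice {L : Type u} [CompleteLattice L] (S : Set L) : Prop :=
  ∀ T : Set L, T ⊆ S → T.Nonempty → sSup T ∈ S ∧ sInf T ∈ S

/-- `X` generates the complete lattice `L`: the only complete sublattice including `X` is `L`. -/
def GeneratesCompleteLattice {L : Type u} [CompleteLattice L] (X : Set L) : Prop :=
  ∀ S : Set L, IsCompleteSublattice S → X ⊆ S → S = Set.univ

/-- `X` generates the complete involution lattice `L`: the only complete sublattice that is closed
with respect to the involution and includes `X` is `L`. -/
def GeneratesCompleteInvolutionLattice {L : Type u} [CompleteInvolutionLattice L]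
    (X : Set L) : Prop :=
  ∀ S : Set L, IsCompleteSublattice S → (∀ x ∈ S, x⁻¹ ∈ S) → X ⊆ S → S = Set.univ

/-- The complete lattice `L` can be generated by a `k`-element subset. -/
def IsGeneratedAsCompleteLattice (k : ℕ) (L : Type u) [CompleteLattice L] : Prop :=
  ∃ X : Set L, X.encard = k ∧ GeneratesCompleteLattice X

/-- The complete involution lattice `L` can be generated by a `k`-element subset. -/
def IsGeneratedAsCompleteInvolutionLattice (k : ℕ) (L : Type u)
    [CompleteInvolutionLattice L] : Prop :=
  ∃ X : Set L, X.encard = k ∧ GeneratesCompleteInvolutionLattice X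

/-- The transitive binary relations on `A`, as sets of ordered pairs. -/
def Tran (A : Type u) : Type u := {r : Set (A × A) // ∀ x y z, (x, y) ∈ r → (y, z) ∈ r → (x, z) ∈ r}

namespace Tran

variable {A : Type u}

/-- Transitive relations are ordered by inclusion. -/
instance : PartialOrder (Tran A) :=
  inferInstanceAs (PartialOrder {r : Set (A × A) // ∀ x y z, (x, y) ∈ r → (y, z) ∈ r → (x, z) ∈ r})

/-- The meet of a family of transitive relations is their intersection. -/
instance : InfSet (Tran A) where
  sInf T := ⟨{p | ∀ r ∈ T, p ∈ r.1},
    fun x y z hxy hyz r hr => r.2 x y z (hxy r hr) (hyz r hr)⟩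

theorem isGLB_sInf (T : Set (Tran A)) : IsGLB T (sInf T) :=
  ⟨fun r hr _ hp => hp r hr, fun _ hs _ hp _ hr => hs hr hp⟩

/-- The complete lattice of transitive relations, ordered by inclusion; joins are the least upper
bounds for this order. -/
instance : CompleteLattice (Tran A) := completeLatticeOfInf (Tran A) isGLB_sInf

/-- The complete involution lattice of transitive relations; the involution sends a relation to its
inverse. -/
instance : CompleteInvolutionLattice (Tran A) where
  inv r := ⟨{p | (p.2, p.1) ∈ r.1}, fun x y z hxy hyz => r.2 z y x hyz hxy⟩
  inv_inv _ := rfl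
  inv_le_inv_of_le _ _ h _ hp := h hp

end Tran

/-! Call two points linked if both ordered pairs on them, as one-element relations, lie in the given
sublattice `S`. Once all pairs of distinct points are linked, `S` is everything (`Linked.eq_univ`).
Links compose: two singletons a → b → c generate only these two pairs and a → c, so meeting the
joins of two such paths with different middle points isolates a → c (`single_mem_of_two_paths`).
Hence it suffices to link each point to a small base.

For three relations to suffice on a large set, the points are coded by sets of earlier points. The
relation `alpha` joins the members of the code of `X i` to `X i`, `gamma` joins `X (m j)` to `Y j`,
and `delta` selects the targets that matter. Meets of the generators and their inverses link `p`,
`q`, `r`. If every member of `φ i` is linked, then meeting the relations `alpha` ⊔ (s → member), and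
`delta`, leaves only pairs s → `X k` with `φ i ⊆ φ k`; the antichain condition forces k = i
(`single_start_X_mem`). Then `gamma` passes from `X (m j)` to `Y j` (`single_p_Y_mem`), and
well-founded recursion reaches every point (`Pt.eq_univ`).

Accessibility is what makes such codes exist: subsets of a coded set yield up to 2^μ new codes, and
a disjoint union of coded sets is coded by naming its component (`IsAccessibleCardinal.hasSetCode`).
Six generators replace three by adjoining the inverses. -/

section Closure

variable {L : Type u} [CompleteLattice L] {S : Set L}

theorem IsCompleteSublattice.sup_mem (hS : IsCompleteSublattice S) {x y : L} (hx : x ∈ S)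
    (hy : y ∈ S) : x ⊔ y ∈ S := by
  rw [← sSup_pair]
  exact (hS {x, y} (by rintro z (rfl | rfl) <;> assumption) ⟨x, Or.inl rfl⟩).1

theorem IsCompleteSublattice.inf_mem (hS : IsCompleteSublattice S) {x y : L} (hx : x ∈ S)
    (hy : y ∈ S) : x ⊓ y ∈ S := by
  rw [← sInf_pair]
  exact (hS {x, y} (by rintro z (rfl | rfl) <;> assumption) ⟨x, Or.inl rfl⟩).2

end Closure

/-! ### Singleton relations and linked sets of points -/

namespace Tran

variable {A : Type u}

/-- The relation `R` relates `x` to `y`. -/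
def Rel (R : Tran A) (x y : A) : Prop := (x, y) ∈ R.1

/-- A transitive relation given as a binary predicate. -/
def ofRel (R : A → A → Prop) (h : ∀ x y z, R x y → R y z → R x z) : Tran A :=
  ⟨{p | R p.1 p.2}, h⟩

@[simp] theorem ofRel_rel {R : A → A → Prop} {h} {x y : A} : (ofRel R h).Rel x y ↔ R x y := Iff.rfl

theorem Rel.trans {R : Tran A} {x y z : A} (h : R.Rel x y) (h' : R.Rel y z) : R.Rel x z :=
  R.2 x y z h h'

theorem le_iff {R T : Tran A} : R ≤ T ↔ ∀ x y, R.Rel x y → T.Rel x y :=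
  ⟨fun h _ _ hxy => h hxy, fun h p hp => h p.1 p.2 hp⟩

theorem ext_rel {R T : Tran A} (h : ∀ x y, R.Rel x y ↔ T.Rel x y) : R = T :=
  le_antisymm (le_iff.2 fun x y => (h x y).1) (le_iff.2 fun x y => (h x y).2)

@[simp] theorem inv_rel {R : Tran A} {x y : A} : R⁻¹.Rel x y ↔ R.Rel y x := Iff.rfl

@[simp] theorem sInf_rel {T : Set (Tran A)} {x y : A} : (sInf T).Rel x y ↔ ∀ R ∈ T, R.Rel x y :=
  Iff.rfl

@[simp] theorem inf_rel {R T : Tran A} {x y : A} : (R ⊓ T).Rel x y ↔ R.Rel x y ∧ T.Rel x y := by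
  rw [← sInf_pair, sInf_rel]; simp

theorem sup_rel_left {R T : Tran A} {x y : A} (h : R.Rel x y) : (R ⊔ T).Rel x y :=
  le_iff.1 le_sup_left x y h

theorem sup_rel_right {R T : Tran A} {x y : A} (h : T.Rel x y) : (R ⊔ T).Rel x y :=
  le_iff.1 le_sup_right x y h

/-- The relation consisting of a single pair. -/
def single (a b : A) : Tran A :=
  ofRel (fun x y => x = a ∧ y = b) (by grind)

@[simp] theorem single_rel {a b x y : A} : (single a b).Rel x y ↔ x = a ∧ y = b := Iff.rfl

@[simp] theorem single_inv (a b : A) : (single a b)⁻¹ = single b a :=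
  ext_rel fun x y => by simp [and_comm]

theorem single_le {a b : A} {R : Tran A} : single a b ≤ R ↔ R.Rel a b := by
  rw [le_iff]; simp

theorem eq_single {R : Tran A} {a b : A} (h : R.Rel a b)
    (h' : ∀ x y, R.Rel x y → x = a ∧ y = b) : R = single a b :=
  ext_rel fun x y => ⟨h' x y, by rintro ⟨rfl, rfl⟩; exact h⟩

theorem single_sup_single_le {a b c x y : A} (hab : a ≠ b) (hbc : b ≠ c) (hac : a ≠ c)
    (h : (single a b ⊔ single b c).Rel x y) :
    x = a ∧ y = b ∨ x = b ∧ y = c ∨ x = a ∧ y = c := by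
  have : single a b ⊔ single b c ≤
      ofRel (fun x y => x = a ∧ y = b ∨ x = b ∧ y = c ∨ x = a ∧ y = c) (by grind) :=
    sup_le (single_le.2 (by simp)) (single_le.2 (by simp))
  exact le_iff.1 this x y h

theorem single_sup_single_rel (a b c : A) : (single a b ⊔ single b c).Rel a c :=
  Rel.trans (sup_rel_left (by simp : (single a b).Rel a b)) (sup_rel_right (by simp))

variable {S : Set (Tran A)}

/-- The join of the two steps has only three pairs, and meeting with `R` discards the two steps. -/
theorem single_mem_of_path (hS : IsCompleteSublattice S) {a b c : A} {R : Tran A}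
    (hab : single a b ∈ S) (hbc : single b c ∈ S) (hR : R ∈ S) (h₁ : a ≠ b) (h₂ : b ≠ c)
    (h₃ : a ≠ c) (hac : R.Rel a c) (h₄ : ¬ R.Rel a b) (h₅ : ¬ R.Rel b c) : single a c ∈ S := by
  rw [← eq_single (R := (single a b ⊔ single b c) ⊓ R)]
  · exact hS.inf_mem (hS.sup_mem hab hbc) hR
  · exact inf_rel.2 ⟨single_sup_single_rel a b c, hac⟩
  · intro x y h
    obtain ⟨h, h'⟩ := inf_rel.1 h
    rcases single_sup_single_le h₁ h₂ h₃ h with ⟨rfl, rfl⟩ | ⟨rfl, rfl⟩ | ⟨rfl, rfl⟩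
    · exact absurd h' h₄
    · exact absurd h' h₅
    · exact ⟨rfl, rfl⟩

theorem single_mem_of_two_paths (hS : IsCompleteSublattice S) {a b b' c : A}
    (hab : single a b ∈ S) (hbc : single b c ∈ S) (hab' : single a b' ∈ S)
    (hbc' : single b' c ∈ S) (h₁ : a ≠ b) (h₂ : b ≠ c) (h₃ : a ≠ c) (h₄ : a ≠ b') (h₅ : b' ≠ c)
    (h₆ : b ≠ b') : single a c ∈ S :=
  single_mem_of_path hS hab hbc (hS.sup_mem hab' hbc') h₁ h₂ h₃ (single_sup_single_rel _ _ _)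
    (fun h => by have := single_sup_single_le h₄ h₅ h₃ h; grind)
    (fun h => by have := single_sup_single_le h₄ h₅ h₃ h; grind)

/-- `G` is a set of points such that all pairs of different points of `G` are, as singleton
relations, in `S`. -/
def Linked (S : Set (Tran A)) (G : Set A) : Prop :=
  ∀ x ∈ G, ∀ y ∈ G, x ≠ y → single x y ∈ S

/-- Any other point of `G` reaches `x` by two paths, through `u` and through `v`; the involution
gives the way back. -/
theorem Linked.insert (hS : IsCompleteSublattice S) (hinv : ∀ R ∈ S, R⁻¹ ∈ S) {G : Set A}
    (hG : Linked S G) {u v x : A} (hu : u ∈ G) (hv : v ∈ G) (huv : u ≠ v) (hxu : x ≠ u)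
    (hxv : x ≠ v) (hux : single u x ∈ S) (hvx : single v x ∈ S) : Linked S (insert x G) := by
  have key : ∀ w ∈ G, w ≠ x → single w x ∈ S := by
    intro w hw hwx
    by_cases h : w = u
    · rwa [h]
    by_cases h' : w = v
    · rwa [h']
    exact single_mem_of_two_paths hS (hG w hw u hu h) hux (hG w hw v hv h') hvx h hxu.symm hwx h'
      hxv.symm huv
  rintro y (rfl | hy) z (rfl | hz) hyz
  · exact absurd rfl hyz
  · have := hinv _ (key z hz hyz.symm)
    rwa [single_inv] at this
  · exact key y hy hyz
  · exact hG y hy z hz hyz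

theorem Linked.mono {G H : Set A} (hH : Linked S H) (h : G ⊆ H) : Linked S G :=
  fun x hx y hy => hH x (h hx) y (h hy)

/-- The points `a` and `b` serve as the two middle points between any `x` and `y`. -/
theorem linked_setOf_linked (hS : IsCompleteSublattice S) {a b : A} (hab : a ≠ b) :
    Linked S {x | Linked S {a, b, x}} := by
  intro x hx y hy hxy
  have hx : Linked S {a, b, x} := hx
  have hy : Linked S {a, b, y} := hy
  by_cases h₁ : x = a ∨ x = b
  · exact hy x (by grind) y (by grind) hxy
  by_cases h₂ : y = a ∨ y = b
  · exact hx x (by grind) y (by grind) hxy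
  push Not at h₁ h₂
  exact single_mem_of_two_paths hS (hx x (by simp) a (by simp) h₁.1)
    (hy a (by simp) y (by simp) h₂.1.symm) (hx x (by simp) b (by simp) h₁.2)
    (hy b (by simp) y (by simp) h₂.2.symm) h₁.1 h₂.1.symm hxy h₁.2 h₂.2.symm hab

/-- Since nothing enters `s`, the transitive closure adds only pairs that leave `s`. -/
theorem sup_single_rel {R : Tran A} {s a x y : A} (hs : ∀ z, ¬ R.Rel z s) (has : a ≠ s)
    (h : (R ⊔ single s a).Rel x y) : R.Rel x y ∨ x = s ∧ (y = a ∨ R.Rel a y) := by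
  have : R ⊔ single s a ≤ ofRel (fun x y => R.Rel x y ∨ x = s ∧ (y = a ∨ R.Rel a y)) (by
      rintro x y z (h₁ | ⟨rfl, rfl | h₁⟩) (h₂ | ⟨rfl, h₂⟩)
      · exact Or.inl (h₁.trans h₂)
      · exact absurd h₁ (hs _)
      · exact Or.inr ⟨rfl, Or.inr h₂⟩
      · exact absurd rfl has
      · exact Or.inr ⟨rfl, Or.inr (h₁.trans h₂)⟩
      · exact absurd h₁ (hs _)) :=
    sup_le (le_iff.2 fun _ _ h => Or.inl h) (single_le.2 (by simp))
  exact le_iff.1 this x y h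

theorem Linked.eq_univ (hS : IsCompleteSublattice S) (h : Linked S (Set.univ : Set A))
    (hA : 3 ≤ #A) : S = Set.univ := by
  obtain ⟨a₀, b₀, c₀, hab₀, hac₀, hbc₀⟩ : ∃ a b c : A, a ≠ b ∧ a ≠ c ∧ b ≠ c := by
    have h3 : #(Fin 3) = 3 := by simp
    have : Cardinal.lift.{u} #(Fin 3) ≤ Cardinal.lift.{0} #A := by simpa using hA
    obtain ⟨e⟩ := Cardinal.lift_mk_le'.1 this
    exact ⟨e 0, e 1, e 2, by simp, by simp, by simp⟩
  have single_mem : ∀ a b : A, single a b ∈ S := by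
    intro a b
    by_cases hab : a = b
    · subst hab
      obtain ⟨b, c, hab, hac, hbc⟩ : ∃ b c : A, a ≠ b ∧ a ≠ c ∧ b ≠ c := by
        by_cases h₁ : a = a₀
        · exact ⟨b₀, c₀, by grind, by grind, hbc₀⟩
        by_cases h₂ : a = b₀
        · exact ⟨a₀, c₀, by grind, by grind, hac₀⟩
        exact ⟨a₀, b₀, h₁, h₂, hab₀⟩
      have full_le : ∀ b x y : A, (single a b ⊔ single b a).Rel x y →
          (x = a ∨ x = b) ∧ (y = a ∨ y = b) := by
        intro b x y hxy
        have : single a b ⊔ single b a ≤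
            ofRel (fun x y => (x = a ∨ x = b) ∧ (y = a ∨ y = b)) (by grind) :=
          sup_le (single_le.2 (by simp)) (single_le.2 (by simp))
        exact le_iff.1 this x y hxy
      -- A loop is the meet of the full relations on {a, b} and {a, c}; this is where a third point
      -- is needed.
      rw [← eq_single (R := (single a b ⊔ single b a) ⊓ (single a c ⊔ single c a))]
      · exact hS.inf_mem
          (hS.sup_mem (h a trivial b trivial hab) (h b trivial a trivial hab.symm))
          (hS.sup_mem (h a trivial c trivial hac) (h c trivial a trivial hac.symm))
      · exact inf_rel.2 ⟨single_sup_single_rel _ _ _, single_sup_single_rel _ _ _⟩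
      · intro x y hxy
        obtain ⟨h₁, h₂⟩ := inf_rel.1 hxy
        have := full_le b x y h₁
        have := full_le c x y h₂
        grind
    · exact h a trivial b trivial hab
  refine Set.eq_univ_of_forall fun R => ?_
  by_cases hR : ∃ a b, R.Rel a b
  · obtain ⟨a, b, hab⟩ := hR
    have : R = sSup {T | ∃ x y, R.Rel x y ∧ T = single x y} := by
      apply le_antisymm
      · refine le_iff.2 fun x y hxy => single_le.1 (le_sSup ?_)
        exact ⟨x, y, hxy, rfl⟩
      · refine sSup_le ?_
        rintro T ⟨x, y, hxy, rfl⟩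
        exact single_le.2 hxy
    rw [this]
    refine (hS {T | ∃ x y, R.Rel x y ∧ T = single x y} ?_ ⟨single a b, a, b, hab, rfl⟩).1
    rintro T ⟨x, y, -, rfl⟩
    exact single_mem x y
  -- The empty join is not an available operation, so the empty relation is obtained as a meet.
  · have : R = single a₀ b₀ ⊓ single b₀ a₀ := by
      apply ext_rel
      intro x y
      simp only [inf_rel, single_rel]
      grind
    rw [this]
    exact hS.inf_mem (single_mem _ _) (single_mem _ _)

end Tran

/-! ### Codes and the three generators -/

/-- The points on which the three generators are defined: four kinds of base points and two kinds
of points indexed by `I` and by `J`. -/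
inductive Pt (F I J : Type u) : Type u
  | p | q | r
  | f (x : F)
  | X (i : I)
  | Y (j : J)

/-- The set `φ i` of predecessors of `X i` determines `X i` among the points with the same flag,
and every point can be reached by going from `φ i` to `X i` and from `X (m j)` to `Y j`. -/
structure IsCode {F I J : Type u} (flag : I → Prop) (m : J → I) (φ : I → Set (F ⊕ J)) : Prop where
  injective : Function.Injective m
  nonempty : ∀ i, (φ i).Nonempty
  nonempty_of_not_flag : ∀ i, ¬ flag i → Nonempty F
  flag_of_inl_mem : ∀ i x, Sum.inl x ∈ φ i → flag i
  eq_of_subset : ∀ i k, (flag i ↔ flag k) → φ i ⊆ φ k → i = k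
  wf : WellFounded fun i' i => ∃ j, Sum.inr j ∈ φ i ∧ m j = i'

namespace Pt

open Tran

variable {F I J : Type u} (flag : I → Prop) (m : J → I) (φ : I → Set (F ⊕ J))

/-- The predicate of the first generator. -/
def alphaRel : Pt F I J → Pt F I J → Prop
  | q, p => True
  | q, r => True
  | f _, r => True
  | f x, X i => Sum.inl x ∈ φ i
  | Y j, X i => Sum.inr j ∈ φ i
  | _, _ => False

/-- The predicate of the second generator. -/
def gammaRel : Pt F I J → Pt F I J → Prop
  | p, q => True
  | p, r => True
  | p, f _ => True
  | f _, q => True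
  | f _, r => True
  | X i, Y j => m j = i
  | _, _ => False

/-- The predicate of the third generator. -/
def deltaRel : Pt F I J → Pt F I J → Prop
  | r, p => True
  | r, q => True
  | r, X _ => True
  | r, Y _ => True
  | p, Y _ => True
  | q, X i => flag i
  | f _, X i => ¬ flag i
  | _, _ => False

/-- The first generator. -/
def alpha : Tran (Pt F I J) := ofRel (alphaRel φ) (by
  intro x y z; cases x <;> cases y <;> cases z <;> simp [alphaRel])

/-- The second generator. -/
def gamma : Tran (Pt F I J) := ofRel (gammaRel m) (by
  intro x y z; cases x <;> cases y <;> cases z <;> simp [gammaRel])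

/-- The third generator. -/
def delta : Tran (Pt F I J) := ofRel (deltaRel flag) (by
  intro x y z; cases x <;> cases y <;> cases z <;> simp [deltaRel])

@[simp] theorem alpha_rel {x y : Pt F I J} : (alpha φ).Rel x y ↔ alphaRel φ x y := Iff.rfl

@[simp] theorem gamma_rel {x y : Pt F I J} : (gamma m).Rel x y ↔ gammaRel m x y := Iff.rfl

@[simp] theorem delta_rel {x y : Pt F I J} : (delta flag).Rel x y ↔ deltaRel flag x y := Iff.rfl

end Pt

/-! ### Recovering all points from the generators -/

namespace Pt

open Tran

variable {F I J : Type u} {flag : I → Prop} {m : J → I} {φ : I → Set (F ⊕ J)}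
  {S : Set (Tran (Pt F I J))}

/-- The point that an element of `φ i` refers to. -/
def src : F ⊕ J → Pt F I J
  | .inl x => f x
  | .inr j => Y j

theorem single_q_p_mem (hS : IsCompleteSublattice S) (hinv : ∀ R ∈ S, R⁻¹ ∈ S)
    (hφ : IsCode flag m φ) (hα : alpha φ ∈ S) (hγ : gamma m ∈ S) :
    single q p ∈ S := by
  rw [← eq_single (R := alpha φ ⊓ (gamma m)⁻¹)]
  · exact hS.inf_mem hα (hinv _ hγ)
  · simp [alphaRel, gammaRel]
  · intro x y h
    obtain ⟨h₁, h₂⟩ := inf_rel.1 h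
    revert h₁ h₂
    cases x <;> cases y <;> simp [alphaRel, gammaRel]
    intro h₁ h₂
    -- A common pair `Y j` → `X i` would make `i` its own predecessor.
    exact hφ.wf.irrefl.irrefl _ ⟨_, h₁, h₂⟩

theorem single_q_r_mem (hS : IsCompleteSublattice S) (hinv : ∀ R ∈ S, R⁻¹ ∈ S)
    (hα : alpha φ ∈ S) (hδ : delta flag ∈ S) : single q r ∈ S := by
  rw [← eq_single (R := alpha φ ⊓ (delta flag)⁻¹)]
  · exact hS.inf_mem hα (hinv _ hδ)
  · simp [alphaRel, deltaRel]
  · intro x y h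
    obtain ⟨h₁, h₂⟩ := inf_rel.1 h
    revert h₁ h₂
    cases x <;> cases y <;> simp [alphaRel, deltaRel]

theorem single_p_r_mem (hS : IsCompleteSublattice S) (hinv : ∀ R ∈ S, R⁻¹ ∈ S)
    (hγ : gamma m ∈ S) (hδ : delta flag ∈ S) : single p r ∈ S := by
  rw [← eq_single (R := gamma m ⊓ (delta flag)⁻¹)]
  · exact hS.inf_mem hγ (hinv _ hδ)
  · simp [gammaRel, deltaRel]
  · intro x y h
    obtain ⟨h₁, h₂⟩ := inf_rel.1 h
    revert h₁ h₂
    cases x <;> cases y <;> simp [gammaRel, deltaRel]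

theorem linked_base (hS : IsCompleteSublattice S) (hinv : ∀ R ∈ S, R⁻¹ ∈ S)
    (hφ : IsCode flag m φ) (hα : alpha φ ∈ S) (hγ : gamma m ∈ S)
    (hδ : delta flag ∈ S) : Linked S {p, q, r} := by
  have h₁ := single_q_p_mem hS hinv hφ hα hγ
  have h₂ := single_q_r_mem hS hinv hα hδ
  have h₃ := single_p_r_mem hS hinv hγ hδ
  have h₁' := hinv _ h₁
  have h₂' := hinv _ h₂
  have h₃' := hinv _ h₃
  rw [single_inv] at h₁' h₂' h₃'
  rintro x (rfl | rfl | rfl) y (rfl | rfl | rfl) h <;> first | assumption | exact absurd rfl h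

theorem single_f_r_mem [Subsingleton F] (hS : IsCompleteSublattice S)
    (hα : alpha φ ∈ S) (hγ : gamma m ∈ S) (x : F) :
    single (f x) r ∈ S := by
  rw [← eq_single (R := alpha φ ⊓ gamma m)]
  · exact hS.inf_mem hα hγ
  · simp [alphaRel, gammaRel]
  · intro x y h
    obtain ⟨h₁, h₂⟩ := inf_rel.1 h
    revert h₁ h₂
    cases x <;> cases y <;> simp [alphaRel, gammaRel]
    exact Subsingleton.elim _ _

/-- Of the pairs of `gamma`, the first join kills those ending in `r`, and the second kills `p` →
`q`, `f` → `q` and all `X` → `Y`. The pair `p` → `f` survives, through `q` in the first join and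
through `r` in the second. -/
theorem single_p_f_mem [Subsingleton F] (hS : IsCompleteSublattice S)
    (hinv : ∀ R ∈ S, R⁻¹ ∈ S) (hα : alpha φ ∈ S) (hγ : gamma m ∈ S)
    (hδ : delta flag ∈ S) (x : F) : single p (f x) ∈ S := by
  have bound₁ : (alpha φ)⁻¹ ⊔ (gamma m)⁻¹ ≤ ofRel (fun _ y => y ≠ r) (fun _ _ _ _ h => h) := by
    refine sup_le (le_iff.2 ?_) (le_iff.2 ?_) <;> intro x y <;> cases x <;> cases y <;>
      simp [alphaRel, gammaRel]
  have bound₂ : (gamma m)⁻¹ ⊔ (delta flag)⁻¹ ≤ ofRel (fun x y : Pt F I J =>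
      match x, y with
      | _, p => True
      | _, r => True
      | _, f _ => True
      | X _, q => True
      | X _, X _ => True
      | Y _, q => True
      | Y _, X _ => True
      | _, _ => False)
      (by intro x y z; cases x <;> cases y <;> cases z <;> simp) := by
    refine sup_le (le_iff.2 ?_) (le_iff.2 ?_) <;> intro x y <;> cases x <;> cases y <;>
      simp [gammaRel, deltaRel]
  rw [← eq_single (R := (((alpha φ)⁻¹ ⊔ (gamma m)⁻¹) ⊓ ((gamma m)⁻¹ ⊔ (delta flag)⁻¹)) ⊓ gamma m)]
  · exact hS.inf_mem (hS.inf_mem (hS.sup_mem (hinv _ hα) (hinv _ hγ))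
      (hS.sup_mem (hinv _ hγ) (hinv _ hδ))) hγ
  · refine inf_rel.2 ⟨inf_rel.2 ⟨?_, ?_⟩, by simp [gammaRel]⟩
    · exact Rel.trans (y := q) (sup_rel_left (by simp [alphaRel]))
        (sup_rel_right (by simp [gammaRel]))
    · exact Rel.trans (y := r) (sup_rel_right (by simp [deltaRel]))
        (sup_rel_left (by simp [gammaRel]))
  · intro x y h
    obtain ⟨h, h₃⟩ := inf_rel.1 h
    obtain ⟨h₁, h₂⟩ := inf_rel.1 h
    replace h₁ := le_iff.1 bound₁ x y h₁
    replace h₂ := le_iff.1 bound₂ x y h₂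
    clear bound₁ bound₂ h hS hinv hα hγ hδ
    revert h₁ h₂ h₃
    cases x <;> cases y <;> simp [gammaRel]
    exact Subsingleton.elim _ _

theorem not_alpha_and_delta (hφ : IsCode flag m φ) {x y : Pt F I J} (h : (delta flag).Rel x y) :
    ¬ (alpha φ).Rel x y := by
  revert h
  cases x <;> cases y <;> simp [alphaRel, deltaRel]
  exact fun h h' => h (hφ.flag_of_inl_mem _ _ h')

/-- The start `s` is `q` or a point of `F` according to the flag of `i`, so `delta` lets `s` see
only the `X k` with the same flag as `i`. This is why codes need to be incomparable only within one
flag. -/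
theorem single_start_X_mem (hS : IsCompleteSublattice S)
    (hφ : IsCode flag m φ) (hα : alpha φ ∈ S) (hδ : delta flag ∈ S)
    {i : I} {s : Pt F I J} (hs : s = q ∧ flag i ∨ (∃ x, s = f x) ∧ ¬ flag i)
    (h : ∀ a ∈ φ i, single s (src a) ∈ S) : single s (X i) ∈ S := by
  have hs_max : ∀ z, ¬ (alpha φ).Rel z s := by
    rcases hs with ⟨rfl, -⟩ | ⟨⟨x, rfl⟩, -⟩ <;> intro z <;> cases z <;> simp [alphaRel]
  have hne : ∀ a ∈ φ i, src a ≠ s := by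
    rintro (x | j) ha
    · have := hφ.flag_of_inl_mem i x ha
      rcases hs with ⟨rfl, -⟩ | ⟨-, hi⟩
      · simp [src]
      · exact absurd this hi
    · rcases hs with ⟨rfl, -⟩ | ⟨⟨x, rfl⟩, -⟩ <;> simp [src]
  have hδs : (delta flag).Rel s (X i) := by
    rcases hs with ⟨rfl, hi⟩ | ⟨⟨x, rfl⟩, hi⟩ <;> simpa [deltaRel]
  obtain ⟨a₀, ha₀⟩ := hφ.nonempty i
  rw [← eq_single (R := sInf {T | ∃ a ∈ φ i, T = alpha φ ⊔ single s (src a)} ⊓ delta flag)]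
  · refine hS.inf_mem (hS {T | ∃ a ∈ φ i, T = alpha φ ⊔ single s (src a)} ?_
      ⟨_, a₀, ha₀, rfl⟩).2 hδ
    rintro T ⟨a, ha, rfl⟩
    exact hS.sup_mem hα (h a ha)
  · refine inf_rel.2 ⟨sInf_rel.2 ?_, hδs⟩
    rintro T ⟨a, ha, rfl⟩
    refine Rel.trans (y := src a) (sup_rel_right (by simp)) (sup_rel_left ?_)
    cases a <;> exact ha
  · intro x y hxy
    obtain ⟨h₁, h₂⟩ := inf_rel.1 hxy
    have key : ∀ a ∈ φ i, x = s ∧ (y = src a ∨ (alpha φ).Rel (src a) y) := by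
      intro a ha
      refine (sup_single_rel hs_max (hne a ha) (sInf_rel.1 h₁ _ ⟨a, ha, rfl⟩)).resolve_left ?_
      exact not_alpha_and_delta hφ h₂
    obtain ⟨rfl, -⟩ := key a₀ ha₀
    refine ⟨rfl, ?_⟩
    have key : ∀ a ∈ φ i, (alpha φ).Rel (src a) y := by
      intro a ha
      -- From `s`, `delta` leads only to points `X k`, never to a point `src a`.
      refine (key a ha).2.resolve_left ?_
      rintro rfl
      rcases hs with ⟨rfl, -⟩ | ⟨⟨x, rfl⟩, -⟩ <;> cases a <;> simp [src, deltaRel] at h₂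
    obtain ⟨k, rfl⟩ : ∃ k, y = X k := by
      rcases hs with ⟨rfl, -⟩ | ⟨⟨x, rfl⟩, -⟩ <;> cases y <;> simp [deltaRel] at h₂ ⊢
    rw [hφ.eq_of_subset i k ?_ ?_]
    · rcases hs with ⟨rfl, hi⟩ | ⟨⟨x, rfl⟩, hi⟩ <;> simp [deltaRel] at h₂ <;> simp [hi, h₂]
    · intro a ha
      have := key a ha
      cases a <;> exact this

theorem single_src_X_mem (hS : IsCompleteSublattice S)
    (hφ : IsCode flag m φ) (hα : alpha φ ∈ S) {i : I} {s : Pt F I J}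
    (hs : s = q ∧ flag i ∨ (∃ x, s = f x) ∧ ¬ flag i) {a : F ⊕ J} (ha : a ∈ φ i)
    (h : single (src a) s ∈ S) (h' : single s (X i) ∈ S) : single (src a) (X i) ∈ S := by
  refine single_mem_of_path hS h h' hα ?_ ?_ ?_ ?_ ?_ ?_
  · rcases hs with ⟨rfl, hi⟩ | ⟨⟨x, rfl⟩, hi⟩ <;> cases a <;> simp [src]
    exact absurd (hφ.flag_of_inl_mem i _ ha) hi
  · rcases hs with ⟨rfl, hi⟩ | ⟨⟨x, rfl⟩, hi⟩ <;> simp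
  · cases a <;> simp [src]
  · cases a <;> exact ha
  · rcases hs with ⟨rfl, hi⟩ | ⟨⟨x, rfl⟩, hi⟩ <;> cases a <;> simp [src, alphaRel]
  · rcases hs with ⟨rfl, hi⟩ | ⟨⟨x, rfl⟩, hi⟩ <;> simp [alphaRel]
    exact fun h => hi (hφ.flag_of_inl_mem i _ h)

/-- Nothing enters `p` in `gamma`, so adding `p` → `X (m j)` creates only new pairs from `p`, and
`delta` keeps those ending in some `Y`. Injectivity of `m` leaves a single one. -/
theorem single_p_Y_mem (hS : IsCompleteSublattice S)
    (hφ : IsCode flag m φ) (hγ : gamma m ∈ S) (hδ : delta flag ∈ S) {j : J}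
    (h : single p (X (m j)) ∈ S) : single p (Y j) ∈ S := by
  rw [← eq_single (R := (gamma m ⊔ single p (X (m j))) ⊓ delta flag)]
  · exact hS.inf_mem (hS.sup_mem hγ h) hδ
  · refine inf_rel.2 ⟨Rel.trans (y := X (m j)) (sup_rel_right (by simp))
      (sup_rel_left (by simp [gammaRel])), by simp [deltaRel]⟩
  · intro x y hxy
    obtain ⟨h₁, h₂⟩ := inf_rel.1 hxy
    have h₃ := sup_single_rel (by intro z; cases z <;> simp [gammaRel]) (by simp) h₁
    clear h₁ hxy
    revert h₂ h₃
    cases x <;> cases y <;> simp [gammaRel, deltaRel]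
    exact fun h => hφ.injective h

theorem single_X_Y_mem (hS : IsCompleteSublattice S)
    (hγ : gamma m ∈ S) {j : J} (h : single (X (m j)) p ∈ S)
    (h' : single p (Y j) ∈ S) : single (X (m j)) (Y j) ∈ S :=
  single_mem_of_path hS h h' hγ (by simp) (by simp) (by simp) (by simp [gammaRel])
    (by simp [gammaRel]) (by simp [gammaRel])

theorem eq_univ [Subsingleton F] (hS : IsCompleteSublattice S) (hinv : ∀ R ∈ S, R⁻¹ ∈ S)
    (hφ : IsCode flag m φ) (hα : alpha φ ∈ S) (hγ : gamma m ∈ S) (hδ : delta flag ∈ S)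
    (hcard : 3 ≤ #(Pt F I J)) : S = Set.univ := by
  -- Membership in `G` only asks for links to `p` and `q`, yet makes all of `G` linked.
  set G : Set (Pt F I J) := {x | Linked S {p, q, x}} with hGdef
  have hG : Linked S G := linked_setOf_linked hS (by simp)
  have hbase : Linked S {p, q, r} := linked_base hS hinv hφ hα hγ hδ
  have hr : r ∈ G := hbase
  have hp : p ∈ G := hbase.mono (by grind)
  have hq : q ∈ G := hbase.mono (by grind)
  have mem_of_insert : ∀ x, Linked S (insert x G) → x ∈ G := fun x hx =>
    hx.mono (by rintro y (rfl | rfl | rfl) <;> simp [hp, hq])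
  have mem_of_two : ∀ u v x, u ∈ G → v ∈ G → u ≠ v → x ≠ u → x ≠ v → single u x ∈ S →
      single v x ∈ S → x ∈ G := fun u v x hu hv huv hxu hxv h h' =>
    mem_of_insert x (hG.insert hS hinv hu hv huv hxu hxv h h')
  have hf : ∀ x, f x ∈ G := by
    intro x
    have h := hinv _ (single_f_r_mem hS hα hγ x)
    rw [single_inv] at h
    exact mem_of_two p r (f x) hp hr (by simp) (by simp) (by simp)
      (single_p_f_mem hS hinv hα hγ hδ x) h
  have hY : ∀ j, X (m j) ∈ G → Y j ∈ G := by
    intro j hj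
    have h := single_p_Y_mem hS hφ hγ hδ (hG p hp _ hj (by simp))
    exact mem_of_two p (X (m j)) (Y j) hp hj (by simp) (by simp) (by simp) h
      (single_X_Y_mem hS hγ (hG _ hj p hp (by simp)) h)
  have hX : ∀ i, X i ∈ G := by
    intro i
    induction i using hφ.wf.induction with
    | _ i ih =>
      have hsrc : ∀ a ∈ φ i, src a ∈ G := by
        rintro (x | j) ha
        · exact hf x
        · exact hY j (ih (m j) ⟨j, ha, rfl⟩)
      obtain ⟨s, hsG, hs⟩ : ∃ s : Pt F I J, s ∈ G ∧
          (s = q ∧ flag i ∨ (∃ x, s = f x) ∧ ¬ flag i) := by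
        by_cases hi : flag i
        · exact ⟨q, hq, Or.inl ⟨rfl, hi⟩⟩
        · obtain ⟨x⟩ := hφ.nonempty_of_not_flag i hi
          exact ⟨f x, hf x, Or.inr ⟨⟨x, rfl⟩, hi⟩⟩
      have hne : ∀ a ∈ φ i, s ≠ src a := by
        rintro (x | j) ha <;> rcases hs with ⟨rfl, hi⟩ | ⟨⟨y, rfl⟩, hi⟩ <;> simp [src]
        exact absurd (hφ.flag_of_inl_mem i _ ha) hi
      have hsX := single_start_X_mem hS hφ hα hδ hs
        fun a ha => hG s hsG _ (hsrc a ha) (hne a ha)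
      obtain ⟨a, ha⟩ := hφ.nonempty i
      refine mem_of_two s (src a) (X i) hsG (hsrc a ha) (hne a ha) ?_ ?_ hsX
        (single_src_X_mem hS hφ hα hs ha (hG _ (hsrc a ha) s hsG (hne a ha).symm) hsX)
      · rcases hs with ⟨rfl, hi⟩ | ⟨⟨y, rfl⟩, hi⟩ <;> simp
      · cases a <;> simp [src]
  refine Linked.eq_univ hS (hG.mono fun x _ => ?_) hcard
  cases x with
  | p => exact hp
  | q => exact hq
  | r => exact hr
  | f x => exact hf x
  | X i => exact hX i
  | Y j => exact hY j (hX _)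

end Pt

/-! ### Set codes on accessible cardinals -/

/-- A family of sets of natural numbers and of earlier points, one for each point of `B`, forming
an antichain. -/
structure IsSetCode {B : Type u} (code : B → Set (ℕ ⊕ B)) : Prop where
  nonempty : ∀ b, (code b).Nonempty
  eq_of_subset : ∀ b c, code b ⊆ code c → b = c
  wf : WellFounded fun b' b => Sum.inr b' ∈ code b

/-- Some type of cardinality `κ` carries a set code. -/
def HasSetCode (κ : Cardinal.{u}) : Prop :=
  ∃ (B : Type u) (code : B → Set (ℕ ⊕ B)), #B = κ ∧ IsSetCode code

theorem hasSetCode_of_le_aleph0 {κ : Cardinal.{u}} (hκ : κ ≤ ℵ₀) : HasSetCode κ := by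
  have : Countable κ.out := by rwa [← Cardinal.mk_le_aleph0_iff, Cardinal.mk_out]
  obtain ⟨g, hg⟩ := exists_injective_nat κ.out
  refine ⟨κ.out, fun b => {Sum.inl (g b)}, Cardinal.mk_out κ, fun b => ⟨_, rfl⟩, ?_, ?_⟩
  · intro b c h
    simpa [hg.eq_iff] using h
  · exact ⟨fun b => ⟨b, fun c hc => by simp at hc⟩⟩

/-- The set code on two copies of `C` and the type `N`, whose points are coded by subsets
of `C`. -/
def powerCode {C N : Type u} (code : C → Set (ℕ ⊕ C)) (g : N → Set C) :
    C ⊕ C ⊕ N → Set (ℕ ⊕ (C ⊕ C ⊕ N))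
  | .inl c => {t | match t with
    | .inl n => n = 0 ∨ ∃ k, n = k + 3 ∧ Sum.inl k ∈ code c
    | .inr (.inl c') => Sum.inr c' ∈ code c
    | .inr (.inr _) => False}
  | .inr (.inl c) => {t | match t with
    | .inl n => n = 1
    | .inr (.inl c') => c' = c
    | .inr (.inr _) => False}
  | .inr (.inr x) => {t | match t with
    | .inl n => n = 2
    | .inr (.inl c) => c ∈ g x
    | .inr (.inr (.inl c)) => c ∉ g x
    | .inr (.inr (.inr _)) => False}

/-- The labels 0, 1, 2 keep the three summands incomparable, and the shift by 3 keeps old labels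
apart from them. A subset is coded by its members in the first copy of `C` and its non-members in
the second, so an inclusion of codes forces equality. -/
theorem isSetCode_powerCode {C N : Type u} {code : C → Set (ℕ ⊕ C)} (hcode : IsSetCode code)
    {g : N → Set C} (hg : Function.Injective g) : IsSetCode (powerCode code g) where
  nonempty := by
    rintro (c | c | x)
    · exact ⟨Sum.inl 0, Or.inl rfl⟩
    · exact ⟨Sum.inl 1, rfl⟩
    · exact ⟨Sum.inl 2, rfl⟩
  eq_of_subset := by
    rintro (b | b | x) (c | c | y) h
    · refine congrArg _ (hcode.eq_of_subset b c ?_)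
      rintro (n | b') hb
      · have : Sum.inl (n + 3) ∈ powerCode code g (.inl c) := h (Or.inr ⟨n, rfl, hb⟩)
        rcases this with h0 | ⟨k, hk, hc⟩
        · omega
        · rwa [show n = k by omega]
      · exact h (a := Sum.inr (.inl b')) hb
    · exact absurd (h (a := Sum.inl 0) (Or.inl rfl)) (by simp [powerCode])
    · exact absurd (h (a := Sum.inl 0) (Or.inl rfl)) (by simp [powerCode])
    · exact absurd (h (a := Sum.inl 1) rfl) (by simp [powerCode])
    · have : b = c := h (a := Sum.inr (.inl b)) rfl
      rw [this]
    · exact absurd (h (a := Sum.inl 1) rfl) (by simp [powerCode])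
    · exact absurd (h (a := Sum.inl 2) rfl) (by simp [powerCode])
    · exact absurd (h (a := Sum.inl 2) rfl) (by simp [powerCode])
    · have : g x = g y := by
        ext c
        refine ⟨fun hc => h (a := Sum.inr (.inl c)) hc, fun hc => ?_⟩
        by_contra hc'
        exact h (a := Sum.inr (.inr (.inl c))) hc' hc
      rw [hg this]
  wf := by
    have h₁ : ∀ c, Acc (fun b' b => Sum.inr b' ∈ powerCode code g b) (.inl c) := by
      intro c
      induction c using hcode.wf.induction with
      | _ c ih =>
        refine ⟨_, ?_⟩
        rintro (c' | c') h
        · exact ih c' h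
        · exact False.elim h
    have h₂ : ∀ c, Acc (fun b' b => Sum.inr b' ∈ powerCode code g b) (.inr (.inl c)) := by
      refine fun c => ⟨_, ?_⟩
      rintro (c' | c') h
      · exact h₁ c'
      · exact False.elim h
    refine ⟨?_⟩
    rintro (c | c | x)
    · exact h₁ c
    · exact h₂ c
    · refine ⟨_, ?_⟩
      rintro (c | c | y) h
      · exact h₁ c
      · exact h₂ c
      · exact False.elim h

/-- The set code on the disjoint union of the types `C k`, for `k` in `K`, and of `K` itself. -/
def sigmaCode {K : Type u} {C : K → Type u} (codeK : K → Set (ℕ ⊕ K))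
    (code : ∀ k, C k → Set (ℕ ⊕ C k)) : K ⊕ (Σ k, C k) → Set (ℕ ⊕ (K ⊕ Σ k, C k))
  | .inl k => {t | match t with
    | .inl n => n = 0 ∨ ∃ l, n = l + 2 ∧ Sum.inl l ∈ codeK k
    | .inr (.inl k') => Sum.inr k' ∈ codeK k
    | .inr (.inr _) => False}
  | .inr ⟨k, c⟩ => {t | match t with
    | .inl n => n = 1 ∨ ∃ l, n = l + 2 ∧ Sum.inl l ∈ code k c
    | .inr (.inl k') => k' = k
    | .inr (.inr x) => ∃ c', x = ⟨k, c'⟩ ∧ Sum.inr c' ∈ code k c}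

/-- A point of `C k` names `k` in its code, so comparable codes lie in one component, where `hC`
applies; the labels 0 and 1 separate `K` from the components. -/
theorem isSetCode_sigmaCode {K : Type u} {C : K → Type u} {codeK : K → Set (ℕ ⊕ K)}
    {code : ∀ k, C k → Set (ℕ ⊕ C k)} (hK : IsSetCode codeK) (hC : ∀ k, IsSetCode (code k)) :
    IsSetCode (sigmaCode codeK code) where
  nonempty := by
    rintro (k | ⟨k, c⟩)
    · exact ⟨Sum.inl 0, Or.inl rfl⟩
    · exact ⟨Sum.inl 1, Or.inl rfl⟩
  eq_of_subset := by
    rintro (k | ⟨k, c⟩) (l | ⟨l, d⟩) h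
    · refine congrArg _ (hK.eq_of_subset k l ?_)
      rintro (n | k') hk
      · have : Sum.inl (n + 2) ∈ sigmaCode codeK code (.inl l) := h (Or.inr ⟨n, rfl, hk⟩)
        rcases this with h0 | ⟨i, hi, hl⟩
        · omega
        · rwa [show n = i by omega]
      · exact h (a := Sum.inr (.inl k')) hk
    · exact absurd (h (a := Sum.inl 0) (Or.inl rfl)) (by simp [sigmaCode])
    · exact absurd (h (a := Sum.inl 1) (Or.inl rfl)) (by simp [sigmaCode])
    · have : k = l := h (a := Sum.inr (.inl k)) rfl
      subst this
      rw [(hC k).eq_of_subset c d]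
      rintro (n | c') hc
      · have : Sum.inl (n + 2) ∈ sigmaCode codeK code (.inr ⟨k, d⟩) := h (Or.inr ⟨n, rfl, hc⟩)
        rcases this with h0 | ⟨i, hi, hl⟩
        · omega
        · rwa [show n = i by omega]
      · obtain ⟨c'', hc'', hd⟩ := h (a := Sum.inr (.inr ⟨k, c'⟩)) ⟨c', rfl, hc⟩
        obtain rfl : c' = c'' := by simpa using hc''
        exact hd
  wf := by
    have h₁ : ∀ k, Acc (fun b' b => Sum.inr b' ∈ sigmaCode codeK code b) (.inl k) := by
      intro k
      induction k using hK.wf.induction with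
      | _ k ih =>
        refine ⟨_, ?_⟩
        rintro (k' | c) h
        · exact ih k' h
        · exact False.elim h
    refine ⟨?_⟩
    rintro (k | ⟨k, c⟩)
    · exact h₁ k
    · induction c using (hC k).wf.induction with
      | _ c ih =>
        refine ⟨_, ?_⟩
        rintro (k' | x) h
        · exact h₁ k'
        · obtain ⟨c', rfl, hc'⟩ := h
          exact ih c' hc'

theorem HasSetCode.of_le_two_power {μ κ : Cardinal.{u}} (h : HasSetCode μ) (hμ : μ < κ)
    (hκ : ℵ₀ ≤ κ) (hle : κ ≤ 2 ^ μ) : HasSetCode κ := by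
  obtain ⟨C, code, rfl, hcode⟩ := h
  have : #κ.out ≤ #(Set C) := by rwa [Cardinal.mk_out, Cardinal.mk_set]
  obtain ⟨g⟩ := this
  refine ⟨_, _, ?_, isSetCode_powerCode hcode g.injective⟩
  rw [Cardinal.mk_sum, Cardinal.mk_sum, Cardinal.mk_out]
  simp only [Cardinal.lift_id]
  rw [Cardinal.add_eq_right hκ hμ.le, Cardinal.add_eq_right hκ hμ.le]

theorem HasSetCode.of_le_sum {κ : Cardinal.{u}} (hκ : ℵ₀ ≤ κ) {I : Set Cardinal.{u}}
    (hsum : Cardinal.lift.{u + 1} κ ≤ Cardinal.sum (fun μ : I => (μ : Cardinal.{u})))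
    (hI : #I < Cardinal.lift.{u + 1} κ) (hlt : ∀ μ ∈ I, μ < κ)
    (ih : ∀ μ < κ, HasSetCode μ) : HasSetCode κ := by
  -- As `I` has fewer than `κ` elements, it can be reindexed by a type `K` in the lower universe,
  -- which carries a set code by induction.
  obtain ⟨ν, hνI, hν⟩ := Cardinal.lt_lift_iff.1 hI
  obtain ⟨K, codeK, rfl, hK⟩ := ih ν hνI
  obtain ⟨e⟩ : Nonempty (K ≃ I) := by
    rw [← Cardinal.lift_mk_eq', hν, Cardinal.lift_id'.{u, u + 1}]
  choose C code hC hcode using fun k => ih (e k) (hlt _ (e k).2)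
  refine ⟨_, _, ?_, isSetCode_sigmaCode hK hcode⟩
  rw [Cardinal.mk_sum, Cardinal.lift_id, Cardinal.lift_id]
  apply le_antisymm
  · refine Cardinal.add_le_of_le hκ hνI.le ?_
    rw [Cardinal.mk_sigma]
    calc Cardinal.sum (fun k => #(C k)) ≤ Cardinal.sum (fun _ : K => κ) :=
          Cardinal.sum_le_sum _ _ fun k => by rw [hC]; exact (hlt _ (e k).2).le
      _ = #K * κ := Cardinal.sum_const' _ _
      _ ≤ κ * κ := by gcongr
      _ = κ := Cardinal.mul_eq_self hκ
  · refine le_trans ?_ (self_le_add_left _ _)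
    rw [← Cardinal.lift_le.{u + 1}]
    refine hsum.trans_eq ?_
    have : Cardinal.sum (fun μ : I => (μ : Cardinal.{u})) = #(Σ μ : I, (μ : Cardinal.{u}).out) := by
      simp
    rw [this, ← Cardinal.lift_id'.{u, u + 1} #(Σ μ : I, (μ : Cardinal.{u}).out), eq_comm,
      Cardinal.lift_mk_eq']
    refine ⟨Equiv.sigmaCongr e fun k => Classical.choice (Cardinal.eq.1 ?_)⟩
    rw [hC, Cardinal.mk_out]

theorem IsAccessibleCardinal.hasSetCode {κ : Cardinal.{u}} (h : IsAccessibleCardinal κ) :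
    HasSetCode κ := by
  rcases h with h | ⟨-, h⟩
  · exact hasSetCode_of_le_aleph0 h.le
  induction κ using WellFoundedLT.induction with
  | _ κ ih =>
    rcases le_or_gt κ ℵ₀ with hκ | hκ
    · exact hasSetCode_of_le_aleph0 hκ
    have ih' : ∀ μ < κ, HasSetCode μ := fun μ hμ =>
      ih μ hμ fun l hl hle => h l hl (hle.trans hμ.le)
    rcases h κ hκ le_rfl with ⟨μ, hμ, hle⟩ | ⟨I, hsum, hI, hlt⟩
    · exact (ih' μ hμ).of_le_two_power hμ hκ.le hle
    · exact HasSetCode.of_le_sum hκ.le hsum hI hlt ih'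

/-! ### Codes of every required cardinality -/

/-- The code of a chain of length `k`: each point refers to the preceding one, and the first one
refers to the point of `F`. -/
def chainCode (k l : ℕ) (i : ULift.{u} (Fin k)) : Set (PUnit.{u + 1} ⊕ ULift.{u} (Fin l)) :=
  {t | match t with
    | .inl _ => i.down.val = 0
    | .inr j => j.down.val + 1 = i.down.val}

theorem isCode_chainCode {k l : ℕ} (hlk : l ≤ k) (hkl : k ≤ l + 1) :
    IsCode (fun _ => True) (fun j : ULift.{u} (Fin l) => ⟨Fin.castLE hlk j.down⟩)
      (chainCode.{u} k l) where
  injective := by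
    rintro ⟨i⟩ ⟨j⟩ h
    simpa using h
  nonempty := by
    rintro ⟨⟨_ | i, hi⟩⟩
    · exact ⟨Sum.inl PUnit.unit, rfl⟩
    · exact ⟨Sum.inr ⟨⟨i, by omega⟩⟩, rfl⟩
  nonempty_of_not_flag := by simp
  flag_of_inl_mem := by simp
  eq_of_subset := by
    rintro ⟨⟨_ | i, hi⟩⟩ ⟨⟨j, hj⟩⟩ - h
    · have : j = 0 := h (a := Sum.inl PUnit.unit) rfl
      simp [this]
    · have : i + 1 = j := h (a := Sum.inr ⟨⟨i, by omega⟩⟩) rfl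
      simp [this]
  wf := by
    refine Subrelation.wf ?_ (measure fun i : ULift.{u} (Fin k) => i.down.val).wf
    rintro i' i ⟨j, hj, rfl⟩
    have : j.down.val + 1 = i.down.val := hj
    change j.down.val < i.down.val
    omega

/-- The code extending a set code by an infinite chain which replaces the natural numbers. -/
def treeCode {B : Type u} (code : B → Set (ℕ ⊕ B)) :
    ULift.{u} ℕ ⊕ B → Set (PUnit.{u + 1} ⊕ (ULift.{u} ℕ ⊕ B))
  | .inl n => {t | match t with
    | .inl _ => n.down = 0
    | .inr (.inl k) => k.down + 1 = n.down
    | .inr (.inr _) => False}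
  | .inr b => {t | match t with
    | .inl _ => False
    | .inr (.inl k) => Sum.inl k.down ∈ code b
    | .inr (.inr c) => Sum.inr c ∈ code b}

/-- The flag marks the chain: a chain point's code may be contained in that of a point of `B`, but
the two are never compared. -/
theorem isCode_treeCode {B : Type u} {code : B → Set (ℕ ⊕ B)} (h : IsSetCode code) :
    IsCode (fun i => i.isLeft) id (treeCode code) where
  injective := Function.injective_id
  nonempty := by
    rintro (⟨_ | n⟩ | b)
    · exact ⟨Sum.inl PUnit.unit, rfl⟩
    · exact ⟨Sum.inr (.inl ⟨n⟩), rfl⟩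
    · obtain ⟨k | c, hb⟩ := h.nonempty b
      · exact ⟨Sum.inr (.inl ⟨k⟩), hb⟩
      · exact ⟨Sum.inr (.inr c), hb⟩
  nonempty_of_not_flag := fun _ _ => ⟨PUnit.unit⟩
  flag_of_inl_mem := by
    rintro (n | b) x hx
    · rfl
    · exact False.elim hx
  eq_of_subset := by
    rintro (⟨_ | n⟩ | b) (k | c) hflag hsub
    · have : k.down = 0 := hsub (a := Sum.inl PUnit.unit) rfl
      exact congrArg Sum.inl (ULift.ext _ _ this.symm)
    · simp at hflag
    · have : n + 1 = k.down := hsub (a := Sum.inr (.inl ⟨n⟩)) rfl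
      exact congrArg Sum.inl (ULift.ext _ _ this)
    · simp at hflag
    · simp at hflag
    · refine congrArg _ (h.eq_of_subset b c ?_)
      rintro (k | b') hb
      · exact hsub (a := Sum.inr (.inl ⟨k⟩)) hb
      · exact hsub (a := Sum.inr (.inr b')) hb
  wf := by
    have h₁ : ∀ n : ℕ, Acc (fun i' i => ∃ j, Sum.inr j ∈ treeCode code i ∧ id j = i')
        (.inl ⟨n⟩) := by
      intro n
      induction n with
      | zero =>
        refine ⟨_, ?_⟩
        rintro _ ⟨k | c, hj, rfl⟩
        · exact absurd hj (Nat.succ_ne_zero _)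
        · exact False.elim hj
      | succ n ih =>
        refine ⟨_, ?_⟩
        rintro _ ⟨k | c, hj, rfl⟩
        · have : k.down + 1 = n + 1 := hj
          obtain rfl : k.down = n := by omega
          exact ih
        · exact False.elim hj
    refine ⟨?_⟩
    rintro (n | b)
    · exact h₁ n.down
    · induction b using h.wf.induction with
      | _ b ih =>
        refine ⟨_, ?_⟩
        rintro _ ⟨k | c, hj, rfl⟩
        · exact h₁ k.down
        · exact ih c hj

theorem Pt.mk_eq (F I J : Type u) : #(Pt F I J) = 3 + #F + #I + #J := by
  have e : Pt F I J ≃ ((ULift.{u} (Fin 3) ⊕ F) ⊕ I) ⊕ J :=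
    { toFun := fun
        | .p => .inl (.inl (.inl ⟨0⟩))
        | .q => .inl (.inl (.inl ⟨1⟩))
        | .r => .inl (.inl (.inl ⟨2⟩))
        | .f x => .inl (.inl (.inr x))
        | .X i => .inl (.inr i)
        | .Y j => .inr j
      invFun := fun
        | .inl (.inl (.inl ⟨0⟩)) => .p
        | .inl (.inl (.inl ⟨1⟩)) => .q
        | .inl (.inl (.inl ⟨2⟩)) => .r
        | .inl (.inl (.inr x)) => .f x
        | .inl (.inr i) => .X i
        | .inr j => .Y j
      left_inv := by rintro (_ | _ | _ | _ | _ | _) <;> rfl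
      right_inv := by
        rintro (((⟨k⟩ | _) | _) | _)
        · fin_cases k <;> rfl
        all_goals rfl }
  rw [Cardinal.mk_congr e]
  simp

/-- Some type of cardinality `κ` is of the form `Pt F I J`, with a code. -/
theorem exists_code_of_isAccessibleCardinal {κ : Cardinal.{u}} (h3 : 3 ≤ κ)
    (hκ : IsAccessibleCardinal κ) :
    ∃ (F I J : Type u) (flag : I → Prop) (m : J → I) (φ : I → Set (F ⊕ J)),
      Subsingleton F ∧ IsCode flag m φ ∧ #(Pt F I J) = κ := by
  obtain ⟨B, code, hB, hcode⟩ := hκ.hasSetCode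
  rcases hκ with hfin | ⟨hinf, -⟩
  · obtain ⟨n, rfl⟩ := Cardinal.lt_aleph0.1 hfin
    have hn : 3 ≤ n := by exact_mod_cast h3
    rcases hn.eq_or_lt with rfl | hn
    · refine ⟨PEmpty, PEmpty, PEmpty, fun _ => True, id, fun _ => ∅, inferInstance, ?_, ?_⟩
      · constructor <;> first | exact Function.injective_id | exact ⟨fun x => x.elim⟩ | exact nofun
      · rw [Pt.mk_eq]
        simp
    -- The `n - 4` points other than `p`, `q`, `r` and the point of `F` alternate between `X` and
    -- `Y`, starting with `X`; hence the two rounded halves.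
    · refine ⟨PUnit, ULift (Fin ((n - 3) / 2)), ULift (Fin ((n - 4) / 2)), _, _, _, inferInstance,
        isCode_chainCode (by omega) (by omega), ?_⟩
      rw [Pt.mk_eq]
      simp only [Cardinal.mk_fintype, Fintype.card_punit, Fintype.card_ulift, Fintype.card_fin]
      norm_cast
      omega
  · refine ⟨PUnit, _, _, _, _, _, inferInstance, isCode_treeCode hcode, ?_⟩
    rw [Pt.mk_eq, Cardinal.mk_sum, hB]
    have h1 : (ℵ₀ : Cardinal.{u}) + κ = κ := Cardinal.add_eq_right hinf hinf
    simp only [Cardinal.mk_uLift, Cardinal.mk_nat, Cardinal.lift_id, Cardinal.lift_aleph0, h1,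
      Cardinal.mk_punit]
    rw [add_assoc, Cardinal.add_eq_self hinf]
    exact Cardinal.add_eq_right hinf ((show (3 + 1 : Cardinal.{u}) < ℵ₀ by
      exact_mod_cast Cardinal.natCast_lt_aleph0 (n := 3 + 1)).le.trans hinf)

/-! ### Transport to `A` and removal of the involution -/

namespace Tran

variable {A B : Type u}

/-- Transporting transitive relations along a bijection. -/
def congr (e : A ≃ B) : Tran B ≃o Tran A where
  toFun R := ofRel (fun x y => R.Rel (e x) (e y)) fun _ _ _ => Rel.trans
  invFun R := ofRel (fun x y => R.Rel (e.symm x) (e.symm y)) fun _ _ _ => Rel.trans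
  left_inv R := ext_rel fun x y => by simp
  right_inv R := ext_rel fun x y => by simp
  map_rel_iff' {R T} := by
    simp only [le_iff, Equiv.coe_fn_mk, ofRel_rel]
    exact ⟨fun h x y => by simpa using h (e.symm x) (e.symm y), fun h x y => h _ _⟩

/-- The relations `α`, `γ`, `δ` generate the complete involution lattice of transitive
relations. -/
def Generates (α γ δ : Tran A) : Prop :=
  ∀ S : Set (Tran A), IsCompleteSublattice S → (∀ R ∈ S, R⁻¹ ∈ S) → α ∈ S → γ ∈ S → δ ∈ S →
    S = Set.univ

theorem Generates.congr {α γ δ : Tran B} (h : Generates α γ δ) (e : A ≃ B) :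
    Generates (congr e α) (congr e γ) (congr e δ) := by
  intro S hS hinv hα hγ hδ
  have := h (Tran.congr e ⁻¹' S) ?_ (fun R hR => hinv _ hR) hα hγ hδ
  · refine Set.eq_univ_of_forall fun R => ?_
    have hR : (Tran.congr e).symm R ∈ Tran.congr e ⁻¹' S := this ▸ trivial
    simpa using hR
  · intro T hT hne
    have h := hS (Tran.congr e '' T) (Set.image_subset_iff.2 hT) (hne.image _)
    rw [sSup_image, sInf_image, ← OrderIso.map_sSup, ← OrderIso.map_sInf] at h
    exact h

theorem exists_generates (hA : 3 ≤ #A) (hacc : IsAccessibleCardinal #A) :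
    ∃ α γ δ : Tran A, Generates α γ δ := by
  obtain ⟨F, I, J, flag, m, φ, hF, hφ, hcard⟩ := exists_code_of_isAccessibleCardinal hA hacc
  obtain ⟨e⟩ := Cardinal.eq.1 hcard.symm
  refine ⟨_, _, _, Generates.congr (α := Pt.alpha φ) (γ := Pt.gamma m) (δ := Pt.delta flag) ?_ e⟩
  intro S hS hinv hα hγ hδ
  exact Pt.eq_univ hS hinv hφ hα hγ hδ (hcard ▸ hA)

/-- The involution, as an order isomorphism. -/
def invIso : Tran A ≃o Tran A where
  toFun R := R⁻¹
  invFun R := R⁻¹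
  left_inv _ := rfl
  right_inv _ := rfl
  map_rel_iff' {R T} := by
    rw [le_iff, le_iff]
    exact ⟨fun h x y => h y x, fun h x y => h y x⟩

/-- This set is closed under the involution, so a sublattice containing the generators and their
inverses reduces to the involution case. -/
theorem isCompleteSublattice_inv {S : Set (Tran A)} (hS : IsCompleteSublattice S) :
    IsCompleteSublattice {R | R ∈ S ∧ R⁻¹ ∈ S} := by
  intro T hT hne
  have h₁ := hS T (fun R hR => (hT hR).1) hne
  have h₂ := hS (invIso '' T) (Set.image_subset_iff.2 fun R hR => (hT hR).2) (hne.image _)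
  rw [sSup_image, sInf_image, ← OrderIso.map_sSup, ← OrderIso.map_sInf] at h₂
  exact ⟨⟨h₁.1, h₂.1⟩, h₁.2, h₂.2⟩

theorem nine_le_encard_univ (hA : 3 ≤ #A) : 9 ≤ (Set.univ : Set (Tran A)).encard := by
  have : Cardinal.lift.{u} #(Fin 3) ≤ Cardinal.lift.{0} #A := by simpa using hA
  obtain ⟨e⟩ := Cardinal.lift_mk_le'.1 this
  have hinj : Function.Injective fun x : Fin 3 × Fin 3 => single (e x.1) (e x.2) := by
    rintro ⟨a, b⟩ ⟨c, d⟩ h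
    have h : single (e a) (e b) = single (e c) (e d) := h
    have : (single (e c) (e d)).Rel (e a) (e b) := by rw [← h]; simp
    simpa using this
  rw [Set.encard_univ]
  simpa using ENat.card_le_card_of_injective hinj

end Tran

theorem mainTheorem2 (A : Type u) (hA : 3 ≤ #A) (hacc : IsAccessibleCardinal #A) :
    IsGeneratedAsCompleteLattice 6 (Tran A) ∧
      IsGeneratedAsCompleteInvolutionLattice 3 (Tran A) := by
  obtain ⟨α, γ, δ, h⟩ := Tran.exists_generates hA hacc
  have hcard := Tran.nine_le_encard_univ hA
  have insert_le : ∀ (X : Set (Tran A)) (n : ℕ) (R : Tran A), X.encard ≤ n →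
      (insert R X).encard ≤ (n + 1 : ℕ) := fun X n R hX =>
    (Set.encard_insert_le X R).trans (by push_cast; gcongr)
  constructor
  · have h6 : ({α, γ, δ, α⁻¹, γ⁻¹, δ⁻¹} : Set (Tran A)).encard ≤ 6 :=
      insert_le _ 5 _ <| insert_le _ 4 _ <| insert_le _ 3 _ <| insert_le _ 2 _ <|
        insert_le _ 1 _ (Set.encard_singleton _).le
    -- The six relations may coincide; the set is padded to exactly six elements, and a superset of
    -- a generating set still generates.
    obtain ⟨X, hX, -, hXcard⟩ := Set.exists_superset_subset_encard_eq (Set.subset_univ _) h6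
      (le_trans (by norm_num) hcard)
    refine ⟨X, hXcard, fun S hS hXS => ?_⟩
    have hsub := hX.trans hXS
    have := h {R | R ∈ S ∧ R⁻¹ ∈ S} (Tran.isCompleteSublattice_inv hS)
      (fun R hR => ⟨hR.2, hR.1⟩) ⟨hsub (by simp), hsub (by simp)⟩
      ⟨hsub (by simp), hsub (by simp)⟩ ⟨hsub (by simp), hsub (by simp)⟩
    exact Set.eq_univ_of_forall fun R => (this ▸ trivial : R ∈ {R | R ∈ S ∧ R⁻¹ ∈ S}).1
  · have h3 : ({α, γ, δ} : Set (Tran A)).encard ≤ 3 :=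
      insert_le _ 2 _ <| insert_le _ 1 _ (Set.encard_singleton _).le
    obtain ⟨X, hX, -, hXcard⟩ := Set.exists_superset_subset_encard_eq (Set.subset_univ _) h3
      (le_trans (by norm_num) hcard)
    refine ⟨X, hXcard, fun S hS hinv hXS => ?_⟩
    have hsub := hX.trans hXS
    exact h S hS hinv (hsub (by simp)) (hsub (by simp)) (hsub (by simp))
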